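/- Let $(\Omega,\mathcal F,\mu)$ be a $\sigma$-finite measure space. Sets and functions are identified when they agree up to null sets, relations between measurable functions are meant almost everywhere, $L^0(E)$ is the space of measurable functions $\Omega\to E$ modulo null sets, and a measurable partition is a countable one. \textbf{Conditional Polish spaces.} A conditional set is a non-empty set $H$ with a restriction operation $x\mapsto x|A$ ($A\in\mathcal F$) such that $x|B=y|B$ and $A\subseteq B$ imply $x|A=y|A$, and such that for every sequence $(x_k)$ in $H$ and every measurable partition $(A_k)$ there is a unique $x=\sum_k x_k|A_k\in H$ with $x|A_k=x_k|A_k$ for all $k$. For a sequence $(x_k)$ in $H$ and $n\in L^0(\mathbb N)$ put $x_n:=\sum_k x_k|\{n=k\}$. A conditional metric is a map $d\colon H\times H\to L^0_+(\mathbb R)$ that commutes with concatenations, is symmetric, satisfies the triangle inequality, and has $d(x,y)=0$ if and only if $x=y$. $(H,d)$ is conditionally separable if there is a countable $G\subset H$ such that for each $x\in H$ there are a sequence $(x_k)$ in $G$ and $n_1<n_2<\dots$ in $L^0(\mathbb N)$ with $d(x_{n_m},x)\to0$ almost everywhere. It is conditionally complete if for every sequence $(x_k)$ in $H$ such that for each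 $r\in L^0(\mathbb Q)$, $r>0$, there is $n\in L^0(\mathbb N)$ with $d(x_m,x_p)<r$ for all $m,p\ge n$ in $L^0(\mathbb N)$, there is $x\in H$ with $d(x_k,x)\to0$ almost everywhere. $(H,d)$ is a conditional Polish space if it is both. Two conditional metric spaces are isometric if there is a bijection between them that preserves the conditional metric and equality of restrictions. \textbf{Polish spaces in the conditional model $\mathcal S$.} The natural numbers of $\mathcal S$ are $L^0(\mathbb N)$. Its sets of natural numbers are the conditional subsets $N|A$, where $A\in\mathcal F$ and $N\subset L^0(\mathbb N)$ is non-empty and stable under concatenations; the truth value of $n\in N|A$ is the union, in the measure algebra, of all $A'\subset A$ with $n|A'\in N|A'$. Its real numbers are $L^0(\mathbb R)$, its functions commute with concatenations, and a statement holds in $\mathcal S$ if its truth value is $\Omega$. A Polish space in $\mathcal S$ is given, as in second-order arithmetic, by a set $X$ of natural numbers of $\mathcal S$ that is non-empty in $\mathcal S$ and a pseudometric $d\colon X\times X\to L^0_+(\mathbb R)$ in $\mathcal S$. Its points are the sequences $(a_n)_{n\in L^0(\mathbb N)}$ of elements of $X$ in $\mathcal S$ such that $d(a_m,a_n)\le2^{-m}$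 on $\{m<n\}$ for all $m,n\in L^0(\mathbb N)$. For points $x=(a_n)$, $y=(b_n)$ put $\hat d(x,y)=\lim_n d(a_n,b_n)$ (limit in $\mathcal S$), and identify $x$ with $y$ if $\hat d(x,y)=0$. Let $(\hat X,\hat d)$ be the space of points so obtained, where $x|A=y|A$ means that $\hat d(x,y)=0$ on $A$. Two Polish spaces $(X,d)$, $(X',d')$ in $\mathcal S$ are isometric in $\mathcal S$ if there is, in $\mathcal S$, a distance preserving function from $X$ to points of the second space whose image is dense in $\mathcal S$. \textbf{Proposition.} Conditional Polish spaces correspond one-to-one, up to isometry, to Polish spaces in $\mathcal S$: \begin{itemize} \item[(i)] for every Polish space $(X,d)$ in $\mathcal S$, $(\hat X,\hat d)$ is a conditional Polish space; \item[(ii)] every conditional Polish space is isometric to $(\hat X,\hat d)$ for some Polish space $(X,d)$ in $\mathcal S$; \item[(iii)] if $H$ and $H'$ are conditional Polish spaces that are isometric to $(\hat X,\hat d)$ and $(\hat X',\hat d')$ respectively, then $H$ and $H'$ are isometric if and only if $(X,d)$ and $(X',d')$ are isometric in $\mathcal S$. \end{itemize} -/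

import Mathlib

open MeasureTheory Filter Topology

namespace Cond

universe u v w

section

variable {Ω : Type u} [MeasurableSpace Ω]

/-! ### Measurable functions modulo null sets, measurable partitions, concatenations -/

/-- `L⁰(E)`: measurable functions `Ω → E` modulo almost everywhere equality. -/
abbrev L0 (μ : Measure Ω) (E : Type v) [TopologicalSpace E] : Type (max u v) := Ω →ₘ[μ] E

/-- A (countable) measurable partition of `Ω`; pieces may be empty, so finite partitions are
covered. -/
structure IsPartition (A : ℕ → Set Ω) : Prop where
  measurable : ∀ k, MeasurableSet (A k)
  disjoint : Pairwise fun j k => Disjoint (A j) (A k)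
  cover : ⋃ k, A k = Set.univ

/-- `x|A = y|A` for `x, y ∈ L⁰(E)`. -/
def EqOn {μ : Measure Ω} {E : Type v} [TopologicalSpace E] (A : Set Ω) (x y : L0 μ E) : Prop :=
  ∀ᵐ ω ∂μ, ω ∈ A → x ω = y ω

/-- With respect to a restriction relation `R` (`R A x y` means `x|A = y|A`), the element `z` is a
concatenation `∑ₖ xₖ|Aₖ`. -/
def IsConcat {H : Type v} (R : Set Ω → H → H → Prop) (A : ℕ → Set Ω) (x : ℕ → H) (z : H) : Prop :=
  ∀ k, R (A k) (x k) z

/-- The partition `({n = k})ₖ` attached to `n ∈ L⁰(ℕ)`. -/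
def level {μ : Measure Ω} (n : L0 μ ℕ) (k : ℕ) : Set Ω := {ω | n ω = k}

/-! ### Conditional Polish spaces -/

/-- A conditional set: a non-empty set with a restriction operation, recorded through the relation
`R A x y`, meaning `x|A = y|A`, for `A` in the measure algebra of `μ`. -/
structure IsConditionalSet (μ : Measure Ω) {H : Type v} (R : Set Ω → H → H → Prop) : Prop where
  nonempty : Nonempty H
  refl : ∀ A, MeasurableSet A → ∀ x, R A x x
  symm : ∀ A, MeasurableSet A → ∀ x y, R A x y → R A y x
  trans : ∀ A, MeasurableSet A → ∀ x y z, R A x y → R A y z → R A x z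
  /-- restrictions only depend on the class of `A` modulo null sets -/
  congr : ∀ A B, MeasurableSet A → MeasurableSet B → A =ᵐ[μ] B → ∀ x y, R A x y → R B x y
  /-- consistency -/
  mono : ∀ A B, MeasurableSet A → MeasurableSet B → A ⊆ B → ∀ x y, R B x y → R A x y
  /-- countable families have unique concatenations along measurable partitions -/
  glue : ∀ A, IsPartition A → ∀ x : ℕ → H, ∃! z, IsConcat R A x z

/-- A conditional metric `d : H × H → L⁰₊(ℝ)`. -/
structure IsConditionalMetric (μ : Measure Ω) {H : Type v} (R : Set Ω → H → H → Prop)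
    (d : H → H → L0 μ ℝ) : Prop where
  nonneg : ∀ x y, ∀ᵐ ω ∂μ, 0 ≤ d x y ω
  concat : ∀ A, IsPartition A → ∀ (x y : ℕ → H) (z w : H), IsConcat R A x z → IsConcat R A y w →
    IsConcat EqOn A (fun k => d (x k) (y k)) (d z w)
  eq_zero_iff : ∀ x y, d x y = 0 ↔ x = y
  symm : ∀ x y, d x y = d y x
  triangle : ∀ x y z, ∀ᵐ ω ∂μ, d x z ω ≤ d x y ω + d y z ω

/-- Conditional separability. Here `y` is a sequence in `G`, `n₀ < n₁ < ⋯` in `L⁰(ℕ)`, and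
`z m = ∑ₖ yₖ|{nₘ = k}`. -/
def IsConditionallySeparable (μ : Measure Ω) {H : Type v} (R : Set Ω → H → H → Prop)
    (d : H → H → L0 μ ℝ) : Prop :=
  ∃ G : Set H, G.Countable ∧ ∀ x : H, ∃ y : ℕ → H, (∀ k, y k ∈ G) ∧
    ∃ n : ℕ → L0 μ ℕ, (∀ m, ∀ᵐ ω ∂μ, n m ω < n (m + 1) ω) ∧
      ∃ z : ℕ → H, (∀ m, IsConcat R (level (n m)) y (z m)) ∧
        ∀ᵐ ω ∂μ, Tendsto (fun m => d (z m) x ω) atTop (𝓝 0)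

/-- Conditional Cauchy sequences: for all `r ∈ L⁰₊₊(ℚ)` there is `n ∈ L⁰(ℕ)` with
`d(xₘ, xₚ) < r` for all `m, p ≥ n` in `L⁰(ℕ)`, where `xₘ = ∑ₖ xₖ|{m = k}`. -/
def IsConditionalCauchy {μ : Measure Ω} {H : Type v} (R : Set Ω → H → H → Prop)
    (d : H → H → L0 μ ℝ) (x : ℕ → H) : Prop :=
  ∀ r : L0 μ ℚ, (∀ᵐ ω ∂μ, 0 < r ω) → ∃ n : L0 μ ℕ, ∀ m p : L0 μ ℕ,
    (∀ᵐ ω ∂μ, n ω ≤ m ω) → (∀ᵐ ω ∂μ, n ω ≤ p ω) →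
    ∀ a b : H, IsConcat R (level m) x a → IsConcat R (level p) x b →
      ∀ᵐ ω ∂μ, d a b ω < (r ω : ℝ)

/-- Conditional completeness. -/
def IsConditionallyComplete (μ : Measure Ω) {H : Type v} (R : Set Ω → H → H → Prop)
    (d : H → H → L0 μ ℝ) : Prop :=
  ∀ x : ℕ → H, IsConditionalCauchy R d x →
    ∃ a : H, ∀ᵐ ω ∂μ, Tendsto (fun k => d (x k) a ω) atTop (𝓝 0)

/-- Conditional Polish spaces. -/
structure IsConditionalPolish (μ : Measure Ω) {H : Type v} (R : Set Ω → H → H → Prop)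
    (d : H → H → L0 μ ℝ) : Prop where
  condSet : IsConditionalSet μ R
  condMetric : IsConditionalMetric μ R d
  separable : IsConditionallySeparable μ R d
  complete : IsConditionallyComplete μ R d

/-- Isomorphism of conditional metric spaces: a bijection compatible with restrictions (hence with
concatenations) and with the conditional metrics. -/
def CondIsometric {μ : Measure Ω} {H : Type v} {H' : Type w}
    (R : Set Ω → H → H → Prop) (d : H → H → L0 μ ℝ)
    (R' : Set Ω → H' → H' → Prop) (d' : H' → H' → L0 μ ℝ) : Prop :=
  ∃ f : H ≃ H', (∀ A, MeasurableSet A → ∀ x y, R A x y ↔ R' A (f x) (f y)) ∧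
    ∀ x y, d' (f x) (f y) = d x y

/-! ### The conditional model: number part `L⁰(ℕ)`, set part the conditional power set -/

/-- Elements `N|A` of the conditional power set of `L⁰(ℕ)`: `N` is non-empty and stable under
countable concatenations, and `A` is measurable. -/
structure CondPow (μ : Measure Ω) where
  N : Set (L0 μ ℕ)
  nonempty : N.Nonempty
  stable : ∀ A, IsPartition A → ∀ (x : ℕ → L0 μ ℕ) (z : L0 μ ℕ), (∀ k, x k ∈ N) →
    IsConcat EqOn A x z → z ∈ N
  A : Set Ω
  measurable : MeasurableSet A

/-- The union, in the measure algebra, of the family `𝒢` of measurable sets is `Ω`. -/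
def UnionIsTop (μ : Measure Ω) (𝒢 : Set (Set Ω)) : Prop :=
  ∀ C, MeasurableSet C → (∀ G ∈ 𝒢, μ (G \ C) = 0) → μ Cᶜ = 0

namespace CondPow

variable {μ : Measure Ω}

/-- The family of all measurable `A' ⊆ A` with `n|A' ∈ N|A'`. Its union in the measure algebra is
the truth value `i(n, N|A)` of `n ∈ N|A`. -/
def memSets (X : CondPow μ) (n : L0 μ ℕ) : Set (Set Ω) :=
  {A' | MeasurableSet A' ∧ A' ⊆ X.A ∧ ∃ m ∈ X.N, EqOn A' n m}

/-- `n ∈ X` holds in the model, i.e. `i(n, X) = Ω`. -/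
def Mem (X : CondPow μ) (n : L0 μ ℕ) : Prop := UnionIsTop μ (X.memSets n)

/-- `∃ n, n ∈ X` holds in the model, i.e. `⋃ₙ i(n, X) = Ω`. -/
def IsNonempty (X : CondPow μ) : Prop := UnionIsTop μ (⋃ n, X.memSets n)

/-- The elements of `X` in the model. -/
abbrev Elem (X : CondPow μ) : Type u := {n : L0 μ ℕ // X.Mem n}

/-- Restriction on the elements of `X`. -/
def EqOn (X : CondPow μ) (A : Set Ω) (a b : X.Elem) : Prop := Cond.EqOn A a.1 b.1

end CondPow

/-- Convergence, in the model, of a sequence `(sₙ)`, `n ∈ L⁰(ℕ)`, of real numbers of the model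
to `l`. -/
def CondTendsto {μ : Measure Ω} (s : L0 μ ℕ → L0 μ ℝ) (l : L0 μ ℝ) : Prop :=
  ∀ r : L0 μ ℚ, (∀ᵐ ω ∂μ, 0 < r ω) → ∃ n : L0 μ ℕ, ∀ m : L0 μ ℕ, (∀ᵐ ω ∂μ, n ω ≤ m ω) →
    ∀ᵐ ω ∂μ, |s m ω - l ω| < (r ω : ℝ)

/-- A Polish (complete separable metric) space in the model, in the sense of second-order
arithmetic: a non-empty set `X` of natural numbers with a pseudometric `d : X × X → ℝ`, where every
notion is interpreted in the model; in particular the real numbers are `L⁰(ℝ)` and functions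
are concatenation preserving. The space itself is the completion of `(X, d)` (see `Point`). -/
structure PolishCode (μ : Measure Ω) where
  X : CondPow μ
  nonempty : X.IsNonempty
  d : X.Elem → X.Elem → L0 μ ℝ
  concat : ∀ A, IsPartition A → ∀ (a b : ℕ → X.Elem) (a' b' : X.Elem),
    IsConcat X.EqOn A a a' → IsConcat X.EqOn A b b' →
    IsConcat EqOn A (fun k => d (a k) (b k)) (d a' b')
  self : ∀ a, d a a = 0
  symm : ∀ a b, d a b = d b a
  nonneg : ∀ a b, ∀ᵐ ω ∂μ, 0 ≤ d a b ω
  triangle : ∀ a b c, ∀ᵐ ω ∂μ, d a c ω ≤ d a b ω + d b c ω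

namespace PolishCode

variable {μ : Measure Ω}

/-- (Representatives of) points of the coded space: sequences `(aₙ)`, `n ∈ L⁰(ℕ)`, in `X` such that
`m < n → d(aₘ, aₙ) ≤ 2⁻ᵐ` holds in the model. -/
structure Point (P : PolishCode μ) where
  seq : L0 μ ℕ → P.X.Elem
  concat : ∀ A, IsPartition A → ∀ (n : ℕ → L0 μ ℕ) (n' : L0 μ ℕ),
    IsConcat EqOn A n n' → IsConcat P.X.EqOn A (fun k => seq (n k)) (seq n')
  fast : ∀ m n : L0 μ ℕ, ∀ᵐ ω ∂μ, m ω < n ω → P.d (seq m) (seq n) ω ≤ (1 / 2 : ℝ) ^ (m ω)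

/-- An element of `X`, regarded as a point (constant sequence). -/
def ofElem (P : PolishCode μ) (a : P.X.Elem) : P.Point where
  seq _ := a
  concat _ _ _ _ _ _ := Eventually.of_forall fun _ _ => rfl
  fast m n := by
    rw [P.self]
    filter_upwards [AEEqFun.coeFn_zero (α := Ω) (β := ℝ) (μ := μ)] with ω h _
    rw [h]; simp only [Pi.zero_apply]; positivity

end PolishCode

theorem isPartition_level {μ : Measure Ω} (n : L0 μ ℕ) : IsPartition (level n) where
  measurable k := n.measurable (measurableSet_singleton k)
  disjoint j k h := by
    refine Set.disjoint_left.2 fun ω h1 h2 => ?_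
    exact h (h1.symm.trans h2)
  cover := by ext ω; simp [level]

theorem ae_const {μ : Measure Ω} {E : Type v} [TopologicalSpace E] (c : E) :
    ∀ᵐ ω ∂μ, (AEEqFun.const Ω c : L0 μ E) ω = c := by
  filter_upwards [AEEqFun.coeFn_const (μ := μ) Ω c] with ω h
  simpa using h

theorem CondTendsto.unique {μ : Measure Ω} {s : L0 μ ℕ → L0 μ ℝ} {l l' : L0 μ ℝ}
    (h : CondTendsto s l) (h' : CondTendsto s l') : l = l' := by
  apply AEEqFun.ext
  have key : ∀ j : ℕ, ∀ᵐ ω ∂μ, |l ω - l' ω| ≤ 2 * (1 / ((j : ℝ) + 1)) := by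
    intro j
    have hc := ae_const (μ := μ) (1 / ((j : ℚ) + 1))
    have hpos : ∀ᵐ ω ∂μ, 0 < (AEEqFun.const Ω (1 / ((j : ℚ) + 1)) : L0 μ ℚ) ω := by
      filter_upwards [hc] with ω hω
      rw [hω]; positivity
    obtain ⟨n, hn⟩ := h _ hpos
    obtain ⟨n', hn'⟩ := h' _ hpos
    have hs := AEEqFun.coeFn_sup n n'
    have e1 := hn (n ⊔ n') (by filter_upwards [hs] with ω hω; rw [hω]; exact le_sup_left)
    have e2 := hn' (n ⊔ n') (by filter_upwards [hs] with ω hω; rw [hω]; exact le_sup_right)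
    filter_upwards [e1, e2, hc] with ω h1 h2 h3
    rw [h3] at h1 h2
    push_cast at h1 h2
    rw [abs_lt] at h1 h2
    rw [abs_le]
    constructor <;> linarith [h1.1, h1.2, h2.1, h2.2]
  filter_upwards [ae_all_iff.2 key] with ω hω
  have hlim : Tendsto (fun j : ℕ => 2 * (1 / ((j : ℝ) + 1))) atTop (𝓝 (2 * 0)) :=
    tendsto_one_div_add_atTop_nhds_zero_nat.const_mul 2
  have : |l ω - l' ω| ≤ 2 * 0 := ge_of_tendsto' hlim hω
  have h0 : |l ω - l' ω| = 0 := le_antisymm (by linarith) (abs_nonneg _)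
  exact sub_eq_zero.1 (abs_eq_zero.1 h0)

namespace PolishCode

variable {μ : Measure Ω}

theorem ae_dist_le (P : PolishCode μ) (x y : P.Point) (m n : L0 μ ℕ) :
    ∀ᵐ ω ∂μ, m ω < n ω →
      |P.d (x.seq m) (y.seq m) ω - P.d (x.seq n) (y.seq n) ω| ≤ 2 * (1 / 2 : ℝ) ^ (m ω) := by
  filter_upwards [x.fast m n, y.fast m n,
    P.triangle (x.seq m) (x.seq n) (y.seq m), P.triangle (x.seq n) (y.seq n) (y.seq m),
    P.triangle (x.seq n) (x.seq m) (y.seq n), P.triangle (x.seq m) (y.seq m) (y.seq n)]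
    with ω h1 h2 h3 h4 h5 h6 hmn
  rw [P.symm (y.seq n) (y.seq m)] at h4
  rw [P.symm (x.seq n) (x.seq m)] at h5
  have := h1 hmn
  have := h2 hmn
  rw [abs_le]; constructor <;> linarith

/-- The distance of two points exists as a limit in the model, and also as an almost everywhere
limit along the constant indices. -/
theorem exists_dist (P : PolishCode μ) (x y : P.Point) :
    ∃ l : L0 μ ℝ, CondTendsto (fun n => P.d (x.seq n) (y.seq n)) l ∧
      ∀ᵐ ω ∂μ, Tendsto (fun k : ℕ => P.d (x.seq (AEEqFun.const Ω k)) (y.seq (AEEqFun.const Ω k)) ω)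
        atTop (𝓝 (l ω)) := by
  set D : ℕ → L0 μ ℝ := fun k => P.d (x.seq (AEEqFun.const Ω k)) (y.seq (AEEqFun.const Ω k))
  have hD : ∀ᵐ ω ∂μ, ∀ k l : ℕ, k ≤ l → |D k ω - D l ω| ≤ 2 * (1 / 2 : ℝ) ^ k := by
    rw [ae_all_iff]; intro k; rw [ae_all_iff]; intro l
    filter_upwards [P.ae_dist_le x y (AEEqFun.const Ω k) (AEEqFun.const Ω l),
      ae_const (μ := μ) k, ae_const (μ := μ) l] with ω h hk hl hkl
    rw [hk, hl] at h
    rcases hkl.lt_or_eq with h' | h'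
    · exact h h'
    · subst h'; simp
  have hpow : Tendsto (fun k : ℕ => 2 * (1 / 2 : ℝ) ^ k) atTop (𝓝 0) := by
    have := (tendsto_pow_atTop_nhds_zero_of_lt_one (r := (1 / 2 : ℝ)) (by norm_num)
      (by norm_num)).const_mul 2
    simpa using this
  have hex : ∀ᵐ ω ∂μ, ∃ l : ℝ, Tendsto (fun k => D k ω) atTop (𝓝 l) := by
    filter_upwards [hD] with ω hω
    refine cauchySeq_tendsto_of_complete (cauchySeq_of_le_tendsto_0' (fun k => 2 * (1 / 2 : ℝ) ^ k)
      (fun k l hkl => ?_) hpow)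
    rw [Real.dist_eq]; exact hω k l hkl
  obtain ⟨g, hg, hlim⟩ := exists_stronglyMeasurable_limit_of_tendsto_ae
    (fun k => (D k).aestronglyMeasurable) hex
  refine ⟨AEEqFun.mk g hg.aestronglyMeasurable, ?_, ?_⟩
  · intro r hr
    have hq : ∀ q : ℚ, ∃ n : ℕ, 0 < q → 2 * (1 / 2 : ℝ) ^ n < q := by
      intro q
      by_cases hq : 0 < q
      · have hq' : (0 : ℝ) < q := by exact_mod_cast hq
        obtain ⟨n, hn⟩ := (hpow.eventually (gt_mem_nhds hq')).exists
        exact ⟨n, fun _ => hn⟩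
      · exact ⟨0, fun h => absurd h hq⟩
    choose h hh using hq
    have hmeas : Measurable h := measurable_of_countable h
    refine ⟨AEEqFun.compMeasurable h hmeas r, fun m hm => ?_⟩
    have hcat : IsConcat EqOn (level m) (fun k => (AEEqFun.const Ω k : L0 μ ℕ)) m := by
      intro k
      filter_upwards [ae_const (μ := μ) k] with ω hω hk
      rw [hω]; exact hk.symm
    have hP := P.concat (level m) (isPartition_level m) _ _ _ _
      (x.concat _ (isPartition_level m) _ _ hcat) (y.concat _ (isPartition_level m) _ _ hcat)
    filter_upwards [hm, hr, hD, hlim, AEEqFun.coeFn_mk g hg.aestronglyMeasurable,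
      ae_all_iff.2 hP, AEEqFun.coeFn_compMeasurable h hmeas r] with ω h1 h2 h3 h4 h5 h6 h7
    rw [h7] at h1
    have e : D (m ω) ω = P.d (x.seq m) (y.seq m) ω := h6 (m ω) rfl
    have hle : |D (m ω) ω - g ω| ≤ 2 * (1 / 2 : ℝ) ^ (m ω) :=
      le_of_tendsto ((tendsto_const_nhds.sub h4).abs)
        (eventually_atTop.2 ⟨m ω, fun l hl => h3 _ l hl⟩)
    have hmono : (1 / 2 : ℝ) ^ (m ω) ≤ (1 / 2 : ℝ) ^ (h (r ω)) :=
      pow_le_pow_of_le_one (by norm_num) (by norm_num) h1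
    rw [h5, ← e]
    have := hh (r ω) h2
    linarith
  · filter_upwards [hlim, AEEqFun.coeFn_mk g hg.aestronglyMeasurable] with ω h1 h2
    rw [h2]; exact h1

/-- The distance of two points, `d(x, y) = lim d(aₙ, bₙ)`, the limit being taken in the model. -/
noncomputable def dist (P : PolishCode μ) (x y : P.Point) : L0 μ ℝ :=
  Classical.choose (p := fun l => CondTendsto (fun n => P.d (x.seq n) (y.seq n)) l)
    ((P.exists_dist x y).imp fun _ h => h.1)

theorem dist_spec (P : PolishCode μ) (x y : P.Point) :
    CondTendsto (fun n => P.d (x.seq n) (y.seq n)) (P.dist x y) :=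
  Classical.choose_spec (p := fun l => CondTendsto (fun n => P.d (x.seq n) (y.seq n)) l)
    ((P.exists_dist x y).imp fun _ h => h.1)

theorem dist_tendsto (P : PolishCode μ) (x y : P.Point) :
    ∀ᵐ ω ∂μ, Tendsto (fun k : ℕ => P.d (x.seq (AEEqFun.const Ω k)) (y.seq (AEEqFun.const Ω k)) ω)
      atTop (𝓝 (P.dist x y ω)) := by
  obtain ⟨l, h1, h2⟩ := P.exists_dist x y
  rwa [(P.dist_spec x y).unique h1]

theorem dist_nonneg (P : PolishCode μ) (x y : P.Point) : ∀ᵐ ω ∂μ, 0 ≤ P.dist x y ω := by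
  filter_upwards [P.dist_tendsto x y, ae_all_iff.2 fun k : ℕ =>
    P.nonneg (x.seq (AEEqFun.const Ω k)) (y.seq (AEEqFun.const Ω k))] with ω h1 h2
  exact ge_of_tendsto' h1 h2

theorem dist_self (P : PolishCode μ) (x : P.Point) : P.dist x x = 0 := by
  apply AEEqFun.ext
  filter_upwards [P.dist_tendsto x x, AEEqFun.coeFn_zero (α := Ω) (β := ℝ) (μ := μ)] with ω h1 h2
  rw [h2]
  refine tendsto_nhds_unique h1 ?_
  simp only [P.self]
  rw [h2]; exact tendsto_const_nhds

theorem dist_symm (P : PolishCode μ) (x y : P.Point) : P.dist x y = P.dist y x := by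
  unfold dist
  simp only [P.symm]

theorem dist_triangle (P : PolishCode μ) (x y z : P.Point) :
    ∀ᵐ ω ∂μ, P.dist x z ω ≤ P.dist x y ω + P.dist y z ω := by
  filter_upwards [P.dist_tendsto x y, P.dist_tendsto y z, P.dist_tendsto x z,
    ae_all_iff.2 fun k : ℕ => P.triangle (x.seq (AEEqFun.const Ω k)) (y.seq (AEEqFun.const Ω k))
      (z.seq (AEEqFun.const Ω k))] with ω h1 h2 h3 h4
  exact le_of_tendsto_of_tendsto' h3 (h1.add h2) h4

theorem dist_eq_of_zero (P : PolishCode μ) {x x' y y' : P.Point}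
    (hx : P.dist x x' = 0) (hy : P.dist y y' = 0) : P.dist x y = P.dist x' y' := by
  apply AEEqFun.ext
  have hx' := P.dist_symm x x'
  have hy' := P.dist_symm y y'
  rw [hx] at hx'
  rw [hy] at hy'
  have t1 := P.dist_triangle x x' y
  have t2 := P.dist_triangle x' y' y
  have t3 := P.dist_triangle x' x y'
  have t4 := P.dist_triangle x y y'
  rw [hx] at t1
  rw [← hy'] at t2
  rw [← hx'] at t3
  rw [hy] at t4
  filter_upwards [t1, t2, t3, t4, AEEqFun.coeFn_zero (α := Ω) (β := ℝ) (μ := μ)]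
    with ω h1 h2 h3 h4 h0
  rw [h0] at h1 h2 h3 h4
  simp only [Pi.zero_apply] at h1 h2 h3 h4
  linarith

/-- Points `x, y` are equal in the model if `d(x, y) = 0`. -/
def pointSetoid (P : PolishCode μ) : Setoid P.Point where
  r x y := P.dist x y = 0
  iseqv :=
    { refl := P.dist_self
      symm := fun {x y} h => by rw [P.dist_symm]; exact h
      trans := fun {x y z} h1 h2 => by rw [P.dist_eq_of_zero h1 (P.dist_self z)]; exact h2 }

/-- The coded space: points modulo equality in the model. -/
def Space (P : PolishCode μ) : Type u := Quotient P.pointSetoid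

/-- The metric of the coded space. -/
noncomputable def spaceDist (P : PolishCode μ) (x y : P.Space) : L0 μ ℝ :=
  Quotient.lift₂ (s₁ := P.pointSetoid) (s₂ := P.pointSetoid) P.dist
    (fun _ _ _ _ h1 h2 => P.dist_eq_of_zero h1 h2) x y

/-- The restriction relation of the coded space: `x|A = y|A` if `A` is contained in the truth value
`{d(x, y) = 0}` of `x = y`. -/
def spaceEqOn (P : PolishCode μ) (A : Set Ω) (x y : P.Space) : Prop :=
  ∀ᵐ ω ∂μ, ω ∈ A → P.spaceDist x y ω = 0

/-- Two Polish spaces in the model are isometric in the model: there is, in the model, a function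
`f` from the set `X` of `P` to the points of `Q` which preserves distances and whose image is dense
(so that `f` extends to an isometry of `P` onto `Q`). -/
def Isometric (P Q : PolishCode μ) : Prop :=
  ∃ f : P.X.Elem → Q.Point,
    (∀ A, IsPartition A → ∀ (a : ℕ → P.X.Elem) (a' : P.X.Elem), IsConcat P.X.EqOn A a a' →
      ∀ n : L0 μ ℕ, IsConcat Q.X.EqOn A (fun k => (f (a k)).seq n) ((f a').seq n)) ∧
    (∀ a b, Q.dist (f a) (f b) = P.d a b) ∧
    ∀ (b : Q.X.Elem) (r : L0 μ ℚ), (∀ᵐ ω ∂μ, 0 < r ω) →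
      ∃ a, ∀ᵐ ω ∂μ, Q.dist (f a) (Q.ofElem b) ω < (r ω : ℝ)

end PolishCode

end

end Cond

namespace Cond

universe u v w

section

variable {Ω : Type u} [MeasurableSpace Ω] {μ : Measure Ω}

/-! ### Partitions and indices -/

/-! The metric of a conditional metric space determines its restrictions: `x|A = y|A` exactly when
`d x y` vanishes on `A` (`rel_iff`). A concatenation `z` of `(xₖ)` along a measurable `f : Ω → ℕ` is
therefore characterised by `d (x (f ω)) z ω = 0` almost everywhere, and conditional statements
become pointwise statements about real numbers, valid off countably many null sets.

For (i), the coded space is a completion of `X`: points are glued pointwise, and completeness is a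
diagonal argument with measurable moduli. Separability rests on `exists_generators`: a non-empty set
of natural numbers of the model has a sequence `(gₖ)` such that each element `a` is the
concatenation of `(gₖ)` along the sets `{a = k}`. This is an exhaustion argument for a finite
measure with the same null sets as `μ`.

For (ii), all of `L⁰(ℕ)` serves as `X`: the index `n` names the concatenation along `n` of a
countable dense sequence, and the metric is pulled back.

For (iii), a distance preserving map from `X` with dense image extends to the completion
(`condIsometric_of_dense`). Conversely, an isometry yields only classes of points; representatives
that commute with concatenations are obtained by choosing them on the generators and gluing. -/

theorem isPartition_fiber {f : Ω → ℕ} (hf : Measurable f) : IsPartition fun k => f ⁻¹' {k} where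
  measurable k := hf (measurableSet_singleton k)
  disjoint j k h := Set.disjoint_left.2 fun ω h1 h2 => h (h1.symm.trans h2)
  cover := by ext ω; simp

theorem IsPartition.exists_index {A : ℕ → Set Ω} (hA : IsPartition A) :
    ∃ f : Ω → ℕ, Measurable f ∧ ∀ k ω, ω ∈ A k ↔ f ω = k := by
  have hex : ∀ ω, ∃ k, ω ∈ A k := fun ω => by
    have : ω ∈ ⋃ k, A k := hA.cover ▸ Set.mem_univ ω
    simpa using this
  choose f hf using hex
  have key : ∀ k ω, ω ∈ A k ↔ f ω = k := by
    refine fun k ω => ⟨fun h => ?_, fun h => h ▸ hf ω⟩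
    by_contra hne
    exact Set.disjoint_left.1 (hA.disjoint hne) (hf ω) h
  refine ⟨f, measurable_to_countable' fun k => ?_, key⟩
  have : f ⁻¹' {k} = A k := by ext ω; simp [key]
  exact this ▸ hA.measurable k

theorem exists_measurable_choice {S : ℕ → Set Ω} (hS : ∀ k, MeasurableSet (S k)) :
    ∃ f : Ω → ℕ, Measurable f ∧ ∀ ω, (∃ k, ω ∈ S k) → ω ∈ S (f ω) := by
  classical
  -- Adding the points outside every `S j` makes the least-index search total.
  have hex : ∀ ω, ∃ k, ω ∈ S k ∪ (⋃ j, S j)ᶜ := by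
    intro ω
    by_cases h : ω ∈ ⋃ j, S j
    · obtain ⟨k, hk⟩ := Set.mem_iUnion.1 h
      exact ⟨k, Or.inl hk⟩
    · exact ⟨0, Or.inr h⟩
  refine ⟨fun ω => Nat.find (hex ω), measurable_find hex fun k =>
    (hS k).union (MeasurableSet.iUnion hS).compl, fun ω hω => ?_⟩
  rcases Nat.find_spec (hex ω) with h | h
  · exact h
  · exact absurd (Set.mem_iUnion.2 hω) h

theorem measurable_apply_index {E : Type*} [MeasurableSpace E] {F : ℕ → Ω → E}
    (hF : ∀ k, Measurable (F k)) {f : Ω → ℕ} (hf : Measurable f) :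
    Measurable fun ω => F (f ω) ω :=
  (measurable_from_prod_countable_right (f := fun p : ℕ × Ω => F p.1 p.2) hF).comp
    (hf.prodMk measurable_id)

theorem exists_L0_eq {f : Ω → ℕ} (hf : Measurable f) : ∃ n : L0 μ ℕ, ∀ᵐ ω ∂μ, n ω = f ω :=
  ⟨AEEqFun.mk f hf.aestronglyMeasurable, AEEqFun.coeFn_mk f _⟩

theorem ae_zero : ∀ᵐ ω ∂μ, (0 : L0 μ ℝ) ω = 0 := by
  filter_upwards [AEEqFun.coeFn_zero (α := Ω) (β := ℝ) (μ := μ)] with ω h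
  rw [h]; rfl

theorem eq_zero_of_ae {x : L0 μ ℝ} (h : ∀ᵐ ω ∂μ, x ω = 0) : x = 0 := by
  apply AEEqFun.ext
  filter_upwards [h, ae_zero (μ := μ)] with ω h1 h2
  rw [h1, h2]

theorem ae_eq_zero {x : L0 μ ℝ} (h : x = 0) : ∀ᵐ ω ∂μ, x ω = 0 := h ▸ ae_zero

/-- The partition `A, Aᶜ, ∅, ∅, …`. -/
def splitAt (A : Set Ω) (k : ℕ) : Set Ω := if k = 0 then A else if k = 1 then Aᶜ else ∅

theorem isPartition_splitAt {A : Set Ω} (hA : MeasurableSet A) : IsPartition (splitAt A) := by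
  classical
  have h : splitAt A = fun k => (fun ω => if ω ∈ A then 0 else 1) ⁻¹' {k} := by
    ext k ω
    by_cases hω : ω ∈ A <;> rcases k with _ | _ | k <;> simp [splitAt, hω]
  rw [h]
  exact isPartition_fiber (Measurable.ite hA measurable_const measurable_const)

/-- A positive rational tolerance is eventually met by the powers of `1/2`. -/
theorem exists_pow_lt_rat : ∃ h : ℚ → ℕ, ∀ q, 0 < q → (1 / 2 : ℝ) ^ h q < q := by
  have hq : ∀ q : ℚ, ∃ n : ℕ, 0 < q → (1 / 2 : ℝ) ^ n < q := by
    intro q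
    by_cases hq : 0 < q
    · obtain ⟨n, hn⟩ := exists_pow_lt_of_lt_one (show (0 : ℝ) < q by exact_mod_cast hq)
        (show (1 / 2 : ℝ) < 1 by norm_num)
      exact ⟨n, fun _ => hn⟩
    · exact ⟨0, fun h => absurd h hq⟩
  exact ⟨fun q => (hq q).choose, fun q => (hq q).choose_spec⟩

/-- The factor 3 leaves room for the errors that add up in `isConditionallyComplete_space`. -/
theorem tendsto_zero_of_le_pow {s : ℕ → ℝ} (h0 : ∀ k, 0 ≤ s k)
    (h : ∀ j : ℕ, ∃ N : ℕ, ∀ k, N ≤ k → s k ≤ 3 * (1 / 2 : ℝ) ^ j) :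
    Tendsto s atTop (𝓝 0) := by
  rw [Metric.tendsto_atTop]
  intro ε hε
  obtain ⟨j, hj⟩ := exists_pow_lt_of_lt_one (show (0 : ℝ) < ε / 3 by positivity)
    (show (1 / 2 : ℝ) < 1 by norm_num)
  obtain ⟨N, hN⟩ := h j
  refine ⟨N, fun k hk => ?_⟩
  rw [Real.dist_eq, sub_zero, abs_of_nonneg (h0 k)]
  linarith [hN k hk]

/-! ### Conditional metric spaces -/

section Metric

variable {H : Type v} {R : Set Ω → H → H → Prop} {d : H → H → L0 μ ℝ}

theorem IsConditionalMetric.self (hd : IsConditionalMetric μ R d) (x : H) :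
    ∀ᵐ ω ∂μ, d x x ω = 0 := ae_eq_zero ((hd.eq_zero_iff x x).2 rfl)

theorem IsConditionalMetric.symm_ae (hd : IsConditionalMetric μ R d) (x y : H) :
    ∀ᵐ ω ∂μ, d x y ω = d y x ω := by rw [hd.symm]; exact Eventually.of_forall fun _ => rfl

/-- In a conditional metric space, `x|A = y|A` if and only if `d(x, y) = 0` on `A`. -/
theorem rel_iff (hs : IsConditionalSet μ R) (hd : IsConditionalMetric μ R d) {A : Set Ω}
    (hA : MeasurableSet A) {x y : H} : R A x y ↔ ∀ᵐ ω ∂μ, ω ∈ A → d x y ω = 0 := by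
  have hS := isPartition_splitAt hA
  -- Let `z` be `x` on `A` and `y` off `A`. Since `d` commutes with concatenations, `d z y` is `d x
  -- y` on `A` and zero elsewhere. Hence `z = y` as soon as `d x y` vanishes on `A`.
  have key : ∀ z, IsConcat R (splitAt A) (fun k => if k = 0 then x else y) z →
      ∀ᵐ ω ∂μ, (ω ∈ A → d x y ω = d z y ω) ∧ (ω ∉ A → d z y ω = 0) := by
    intro z hz
    have h := hd.concat _ hS _ (fun _ => y) z y hz fun k => hs.refl _ (hS.measurable k) y
    filter_upwards [h 0, h 1, hd.self y] with ω h0 h1 h2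
    refine ⟨fun hω => h0 (by simpa [splitAt] using hω), fun hω => ?_⟩
    have := h1 (by simpa [splitAt] using hω)
    simpa [h2] using this.symm
  constructor
  · intro h
    have hy : IsConcat R (splitAt A) (fun k => if k = 0 then x else y) y := by
      intro k
      by_cases hk : k = 0
      · subst hk; simpa [splitAt] using h
      · simpa [hk] using hs.refl _ (hS.measurable k) y
    filter_upwards [key y hy, hd.self y] with ω h1 h2 hω
    rw [h1.1 hω, h2]
  · intro h
    obtain ⟨z, hz, -⟩ := hs.glue _ hS fun k => if k = 0 then x else y
    have hzy : z = y := by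
      rw [← hd.eq_zero_iff]
      apply eq_zero_of_ae
      filter_upwards [key z hz, h] with ω h1 h2
      by_cases hω : ω ∈ A
      · rw [← h1.1 hω, h2 hω]
      · exact h1.2 hω
    have := hz 0
    simpa [splitAt, hzy] using this

/-- Countably many conditions, one on each fibre, merge into a single almost everywhere condition;
this is how concatenations are handled from here on. -/
theorem isConcat_fiber_iff (hs : IsConditionalSet μ R) (hd : IsConditionalMetric μ R d)
    {f : Ω → ℕ} (hf : Measurable f) {x : ℕ → H} {z : H} :
    IsConcat R (fun k => f ⁻¹' {k}) x z ↔ ∀ᵐ ω ∂μ, d (x (f ω)) z ω = 0 := by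
  have h : ∀ k, R (f ⁻¹' {k}) (x k) z ↔ ∀ᵐ ω ∂μ, ω ∈ f ⁻¹' {k} → d (x k) z ω = 0 :=
    fun k => rel_iff hs hd (hf (measurableSet_singleton k))
  unfold IsConcat
  simp only [h]
  rw [← ae_all_iff]
  refine eventually_congr (Eventually.of_forall fun ω => ?_)
  simp

theorem isConcat_level_iff (hs : IsConditionalSet μ R) (hd : IsConditionalMetric μ R d)
    {n : L0 μ ℕ} {x : ℕ → H} {z : H} :
    IsConcat R (level n) x z ↔ ∀ᵐ ω ∂μ, d (x (n ω)) z ω = 0 :=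
  isConcat_fiber_iff hs hd n.measurable

theorem exists_glue (hs : IsConditionalSet μ R) (hd : IsConditionalMetric μ R d)
    {f : Ω → ℕ} (hf : Measurable f) (x : ℕ → H) : ∃ z, ∀ᵐ ω ∂μ, d (x (f ω)) z ω = 0 := by
  obtain ⟨z, hz, -⟩ := hs.glue _ (isPartition_fiber hf) x
  exact ⟨z, (isConcat_fiber_iff hs hd hf).1 hz⟩

theorem IsConditionalMetric.ae_triangle (hd : IsConditionalMetric μ R d) (x y z : ℕ → H) :
    ∀ᵐ ω ∂μ, ∀ i j k, d (x i) (z k) ω ≤ d (x i) (y j) ω + d (y j) (z k) ω :=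
  ae_all_iff.2 fun _ => ae_all_iff.2 fun _ => ae_all_iff.2 fun _ => hd.triangle _ _ _

/-- In a conditionally complete space rapid Cauchy sequences converge. -/
theorem exists_tendsto_of_fast (hs : IsConditionalSet μ R) (hd : IsConditionalMetric μ R d)
    (hc : IsConditionallyComplete μ R d) {x : ℕ → H}
    (hx : ∀ᵐ ω ∂μ, ∀ k l, k < l → d (x k) (x l) ω ≤ (1 / 2 : ℝ) ^ k) :
    ∃ a, ∀ᵐ ω ∂μ, Tendsto (fun k => d (x k) a ω) atTop (𝓝 0) := by
  apply hc
  intro r hr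
  obtain ⟨h, hh⟩ := exists_pow_lt_rat
  have hm : Measurable h := measurable_of_countable h
  -- The modulus is a function of the rational `r ω`, so it is measurable because `ℚ` is countable.
  refine ⟨AEEqFun.compMeasurable h hm r, fun m p hnm hnp a b ha hb => ?_⟩
  rw [isConcat_level_iff hs hd] at ha hb
  filter_upwards [hr, hnm, hnp, ha, hb, hx, AEEqFun.coeFn_compMeasurable h hm r,
    hd.ae_triangle (fun _ => a) x (fun _ => b), hd.ae_triangle x x (fun _ => b),
    ae_all_iff.2 fun k => hd.symm_ae a (x k), ae_all_iff.2 fun k => hd.self (x k),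
    ae_all_iff.2 fun k => ae_all_iff.2 fun l => hd.symm_ae (x k) (x l)]
    with ω hr hnm hnp ha hb hx hn t1 t2 hsa h0 hsx
  rw [hn] at hnm hnp
  simp only [Function.comp_apply] at hnm hnp
  have hq := hh _ hr
  have hp : ∀ k, h (r ω) ≤ k → (1 / 2 : ℝ) ^ k ≤ (1 / 2 : ℝ) ^ h (r ω) := fun k hk =>
    pow_le_pow_of_le_one (by norm_num) (by norm_num) hk
  have hpos : (0 : ℝ) ≤ (1 / 2 : ℝ) ^ h (r ω) := by positivity
  have hmp : d (x (m ω)) (x (p ω)) ω ≤ (1 / 2 : ℝ) ^ h (r ω) := by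
    rcases lt_trichotomy (m ω) (p ω) with h1 | h1 | h1
    · exact (hx _ _ h1).trans (hp _ hnm)
    · rw [h1, h0]; exact hpos
    · rw [hsx]; exact (hx _ _ h1).trans (hp _ hnp)
  have e1 := t1 0 (m ω) 0
  have e2 := t2 (m ω) (p ω) 0
  have e3 := hsa (m ω)
  linarith

/-- Limits in a conditional metric space are unique. -/
theorem eq_of_tendsto (hd : IsConditionalMetric μ R d) {x : ℕ → H} {a b : H}
    (ha : ∀ᵐ ω ∂μ, Tendsto (fun k => d (x k) a ω) atTop (𝓝 0))
    (hb : ∀ᵐ ω ∂μ, Tendsto (fun k => d (x k) b ω) atTop (𝓝 0)) : a = b := by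
  rw [← hd.eq_zero_iff]
  apply eq_zero_of_ae
  filter_upwards [ha, hb, hd.nonneg a b, hd.ae_triangle (fun _ => a) x (fun _ => b),
    ae_all_iff.2 fun k => hd.symm_ae a (x k)] with ω h1 h2 h3 h4 h5
  refine le_antisymm ?_ h3
  have h6 := h1.add h2
  rw [add_zero] at h6
  exact ge_of_tendsto' h6 fun k => by simpa [h5 k] using h4 0 k 0

/-- Joint continuity of the conditional metric. -/
theorem dist_eq_of_tendsto (hd : IsConditionalMetric μ R d) {x y : ℕ → H} {a b : H} {l : L0 μ ℝ}
    (ha : ∀ᵐ ω ∂μ, Tendsto (fun k => d (x k) a ω) atTop (𝓝 0))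
    (hb : ∀ᵐ ω ∂μ, Tendsto (fun k => d (y k) b ω) atTop (𝓝 0))
    (hl : ∀ᵐ ω ∂μ, Tendsto (fun k => d (x k) (y k) ω) atTop (𝓝 (l ω))) : d a b = l := by
  apply AEEqFun.ext
  filter_upwards [ha, hb, hl, hd.ae_triangle (fun _ => a) x (fun _ => b),
    hd.ae_triangle x y (fun _ => b), hd.ae_triangle x (fun _ => a) y,
    hd.ae_triangle (fun _ => a) (fun _ => b) y, ae_all_iff.2 fun k => hd.symm_ae a (x k),
    ae_all_iff.2 fun k => hd.symm_ae b (y k)] with ω ha hb hl t1 t2 t3 t4 s1 s2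
  refine tendsto_nhds_unique ?_ hl
  rw [tendsto_iff_dist_tendsto_zero]
  have hsum := ha.add hb
  rw [add_zero] at hsum
  refine squeeze_zero (fun _ => _root_.dist_nonneg) (fun k => ?_) hsum
  have e1 := t1 0 k 0
  have e2 := t2 k k 0
  have e3 := t3 k 0 k
  have e4 := t4 0 0 k
  have e5 := s1 k
  have e6 := s2 k
  rw [Real.dist_eq, abs_le]
  constructor <;> linarith

end Metric

/-! ### Sets of natural numbers of the model -/

namespace CondPow

theorem mem_of_mem_N (X : CondPow μ) (hX : X.IsNonempty) {n : L0 μ ℕ} (hn : n ∈ X.N) :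
    X.Mem n := by
  -- All truth values of membership lie inside `X.A`, so non-emptiness in the model forces `X.A` to
  -- be conull.
  have hA : μ X.Aᶜ = 0 := by
    refine hX _ X.measurable fun G hG => ?_
    obtain ⟨m, hm⟩ := Set.mem_iUnion.1 hG
    simp [Set.sdiff_eq_empty.2 hm.2.1]
  intro C hC h
  have hAC := h X.A ⟨X.measurable, subset_rfl, n, hn, Eventually.of_forall fun _ _ => rfl⟩
  refine measure_mono_null (fun ω hω => ?_) (measure_union_null hA hAC)
  by_cases h : ω ∈ X.A
  · exact Or.inr ⟨h, hω⟩
  · exact Or.inl h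

theorem nonempty_elem (X : CondPow μ) (hX : X.IsNonempty) : Nonempty X.Elem :=
  X.nonempty.elim fun n hn => ⟨n, X.mem_of_mem_N hX hn⟩

theorem mem_of_glue (X : CondPow μ) {f : Ω → ℕ} (hf : Measurable f) (x : ℕ → X.Elem)
    {z : L0 μ ℕ} (hz : ∀ᵐ ω ∂μ, z ω = (x (f ω)).1 ω) : X.Mem z := by
  intro C hC h
  -- Membership of `x k` is tested against `C` enlarged by `{f ≠ k}`, because a set witnessing
  -- membership of `x k` witnesses that of `z` only after intersection with `{f = k}`.
  have key : ∀ k, μ ((C ∪ (f ⁻¹' {k})ᶜ)ᶜ) = 0 := by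
    intro k
    have hk := hf (measurableSet_singleton k)
    refine (x k).2 _ (hC.union hk.compl) fun G hG => ?_
    obtain ⟨hG1, hG2, m, hm, hGm⟩ := hG
    have := h (G ∩ f ⁻¹' {k}) ⟨hG1.inter hk, Set.inter_subset_left.trans hG2, m, hm, by
      filter_upwards [hz, hGm] with ω h1 h2 hω
      have : f ω = k := hω.2
      rw [h1, this, h2 hω.1]⟩
    refine measure_mono_null (fun ω hω => ?_) this
    simp only [Set.mem_sdiff, Set.mem_union, Set.mem_compl_iff, not_or, not_not] at hω
    exact ⟨⟨hω.1, hω.2.2⟩, hω.2.1⟩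
  refine measure_mono_null (fun ω hω => ?_) (measure_iUnion_null key)
  refine Set.mem_iUnion.2 ⟨f ω, ?_⟩
  simpa using hω

theorem exists_glue (X : CondPow μ) {f : Ω → ℕ} (hf : Measurable f) (x : ℕ → X.Elem) :
    ∃ z : X.Elem, ∀ᵐ ω ∂μ, z.1 ω = (x (f ω)).1 ω := by
  obtain ⟨z, hz⟩ := exists_L0_eq (μ := μ)
    (measurable_apply_index (fun k => (x k).1.measurable) hf)
  exact ⟨⟨z, X.mem_of_glue hf x hz⟩, hz⟩

theorem eqOn_refl (X : CondPow μ) (A : Set Ω) (a : X.Elem) : X.EqOn A a a :=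
  Eventually.of_forall fun _ _ => rfl

/-- A non-empty set of natural numbers of the model contains an element that takes the value `k`
wherever some element does. -/
theorem exists_maximal_level [SFinite μ] (X : CondPow μ) (hX : X.IsNonempty) (k : ℕ) :
    ∃ g : X.Elem, ∀ a : X.Elem, ∀ᵐ ω ∂μ, a.1 ω = k → g.1 ω = k := by
  classical
  obtain ⟨a₀⟩ := X.nonempty_elem hX
  set ν := μ.toFinite
  -- The element sought maximises the `ν`-measure of `{a = k}`; gluing a maximising sequence attains
  -- the supremum.
  set S : Set ENNReal := Set.range fun a : X.Elem => ν (level a.1 k)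
  obtain ⟨u, -, hu, huS⟩ := exists_seq_tendsto_sSup (S := S) ⟨_, a₀, rfl⟩ (OrderTop.bddAbove _)
  choose a ha using huS
  obtain ⟨f, hf, hfk⟩ := exists_measurable_choice
    fun j => (isPartition_level (a j).1).measurable k
  obtain ⟨g, hg⟩ := X.exists_glue hf a
  have hle : sSup S ≤ ν (level g.1 k) := by
    refine le_of_tendsto' hu fun j => ?_
    rw [← ha j]
    refine measure_mono_ae ?_
    filter_upwards [toFinite_absolutelyContinuous μ |>.ae_le hg] with ω hω hj
    exact hω.trans (hfk ω ⟨j, hj⟩)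
  refine ⟨g, fun b => ?_⟩
  have hL : ∀ c : X.Elem, MeasurableSet (level c.1 k) := fun c =>
    (isPartition_level c.1).measurable k
  have hm : Measurable fun ω => if ω ∈ level g.1 k then 0 else 1 :=
    Measurable.ite (hL g) measurable_const measurable_const
  -- `c` takes the value `k` wherever `g` or `b` does, so maximality of `g`, with finiteness of `ν`
  -- for the cancellation, leaves only a null set where `b` alone does.
  obtain ⟨c, hc⟩ := X.exists_glue hm fun j => if j = 0 then g else b
  have hc' : ν (level g.1 k ∪ level b.1 k) ≤ ν (level c.1 k) := by
    refine measure_mono_ae ?_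
    filter_upwards [toFinite_absolutelyContinuous μ |>.ae_le hc] with ω hω hj
    change c.1 ω = k
    by_cases h : ω ∈ level g.1 k
    · simp only [h, if_true] at hω
      exact hω.trans h
    · simp only [h, if_false, one_ne_zero] at hω
      exact hω.trans (hj.resolve_left h)
  have hnull : ν (level b.1 k \ level g.1 k) = 0 := by
    have h1 : ν (level g.1 k ∪ level b.1 k) ≤ ν (level g.1 k) :=
      hc'.trans ((show ν (level c.1 k) ≤ sSup S from le_sSup ⟨c, rfl⟩).trans hle)
    rw [← Set.union_sdiff_self, measure_union Set.disjoint_sdiff_right ((hL b).diff (hL g))] at h1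
    have h2 : ν (level g.1 k) + ν (level b.1 k \ level g.1 k) ≤ ν (level g.1 k) + 0 := by
      simpa using h1
    exact le_antisymm ((ENNReal.add_le_add_iff_left (measure_ne_top ν _)).1 h2) zero_le
  have hμ := absolutelyContinuous_toFinite μ hnull
  filter_upwards [measure_eq_zero_iff_ae_notMem.1 hμ] with ω h1 h2
  by_contra h3
  exact h1 ⟨h2, h3⟩

/-- A non-empty set of natural numbers of the model is generated by a sequence. -/
theorem exists_generators [SFinite μ] (X : CondPow μ) (hX : X.IsNonempty) :
    ∃ g : ℕ → X.Elem, ∀ a : X.Elem, ∀ᵐ ω ∂μ, (g (a.1 ω)).1 ω = a.1 ω := by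
  choose g hg using X.exists_maximal_level hX
  refine ⟨g, fun a => ?_⟩
  filter_upwards [ae_all_iff.2 fun k => hg k a] with ω h
  exact h _ rfl

end CondPow

/-! ### Points of a coded space -/

namespace PolishCode

variable (P : PolishCode μ)

theorem ae_self (a : P.X.Elem) : ∀ᵐ ω ∂μ, P.d a a ω = 0 := ae_eq_zero (P.self a)

theorem ae_symm (a b : P.X.Elem) : ∀ᵐ ω ∂μ, P.d a b ω = P.d b a ω := by
  rw [P.symm]; exact Eventually.of_forall fun _ => rfl

/-- `b` is the concatenation of `a` on `{a = b}` with `b` off it, and `d` commutes with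
concatenations. -/
theorem d_eq_zero (a b : P.X.Elem) : ∀ᵐ ω ∂μ, a.1 ω = b.1 ω → P.d a b ω = 0 := by
  have hA : MeasurableSet {ω | a.1 ω = b.1 ω} :=
    measurableSet_eq_fun a.1.measurable b.1.measurable
  have h := P.concat _ (isPartition_splitAt hA) (fun k => if k = 0 then a else b) (fun _ => b) b b
    (fun k => by
      by_cases hk : k = 0
      · subst hk
        exact Eventually.of_forall fun ω hω => by simpa [splitAt] using hω
      · simpa [hk] using P.X.eqOn_refl _ b) fun k => P.X.eqOn_refl _ b
  filter_upwards [h 0, P.ae_self b] with ω h0 h1 hω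
  have := h0 (by simpa [splitAt] using hω)
  simpa [h1] using this

theorem ae_triangle (a b c : ℕ → P.X.Elem) :
    ∀ᵐ ω ∂μ, ∀ i j k, P.d (a i) (c k) ω ≤ P.d (a i) (b j) ω + P.d (b j) (c k) ω :=
  ae_all_iff.2 fun _ => ae_all_iff.2 fun _ => ae_all_iff.2 fun _ => P.triangle _ _ _

/-- The distance of two elements that agree with members of two sequences. -/
theorem d_le_of_eq (a b : P.X.Elem) (s t : ℕ → P.X.Elem) :
    ∀ᵐ ω ∂μ, ∀ i j, a.1 ω = (s i).1 ω → b.1 ω = (t j).1 ω →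
      P.d a b ω = P.d (s i) (t j) ω := by
  filter_upwards [P.ae_triangle (fun _ => a) s (fun _ => b), P.ae_triangle s t (fun _ => b),
    P.ae_triangle s (fun _ => a) t, P.ae_triangle (fun _ => a) (fun _ => b) t,
    ae_all_iff.2 fun i => P.d_eq_zero a (s i), ae_all_iff.2 fun j => P.d_eq_zero b (t j),
    ae_all_iff.2 fun i => P.ae_symm a (s i), ae_all_iff.2 fun j => P.ae_symm b (t j)]
    with ω t1 t2 t3 t4 z1 z2 s1 s2 i j hi hj
  have e1 := t1 0 i 0
  have e2 := t2 i j 0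
  have e3 := t3 i 0 j
  have e4 := t4 0 0 j
  have e5 := z1 i hi
  have e6 := z2 j hj
  have e7 := s1 i
  have e8 := s2 j
  apply le_antisymm <;> linarith

/-- A rapid Cauchy sequence of elements of `X` defines a point. -/
theorem exists_point {a : ℕ → P.X.Elem}
    (ha : ∀ᵐ ω ∂μ, ∀ k l, k < l → P.d (a k) (a l) ω ≤ (1 / 2 : ℝ) ^ k) :
    ∃ x : P.Point, ∀ n, ∀ᵐ ω ∂μ, (x.seq n).1 ω = (a (n ω)).1 ω := by
  choose s hs using fun n : L0 μ ℕ => P.X.exists_glue n.measurable a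
  refine ⟨⟨s, fun A hA n n' hn k => ?_, fun m n => ?_⟩, hs⟩
  · filter_upwards [hs (n k), hs n', hn k] with ω h1 h2 h3 hω
    rw [h1, h2, h3 hω]
  · filter_upwards [hs m, hs n, ha, P.d_le_of_eq (s m) (s n) a a] with ω h1 h2 h3 h4 hmn
    rw [h4 _ _ h1 h2]
    exact h3 _ _ hmn

/-- Points can be concatenated. -/
theorem exists_glue_point {f : Ω → ℕ} (hf : Measurable f) (p : ℕ → P.Point) :
    ∃ q : P.Point, ∀ n, ∀ᵐ ω ∂μ, (q.seq n).1 ω = ((p (f ω)).seq n).1 ω := by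
  choose s hs using fun n : L0 μ ℕ => P.X.exists_glue hf fun j => (p j).seq n
  refine ⟨⟨s, fun A hA n n' hn k => ?_, fun m n => ?_⟩, hs⟩
  · filter_upwards [hs (n k), hs n', ae_all_iff.2 fun j => (p j).concat A hA n n' hn k]
      with ω h1 h2 h3 hω
    rw [h1, h2]
    exact h3 _ hω
  · filter_upwards [hs m, hs n, ae_all_iff.2 fun j => (p j).fast m n,
      P.d_le_of_eq (s m) (s n) (fun j => (p j).seq m) fun j => (p j).seq n] with ω h1 h2 h3 h4 hmn
    rw [h4 _ _ h1 h2]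
    exact h3 _ hmn

theorem dist_ofElem (a b : P.X.Elem) : P.dist (P.ofElem a) (P.ofElem b) = P.d a b := by
  apply AEEqFun.ext
  filter_upwards [P.dist_tendsto (P.ofElem a) (P.ofElem b)] with ω h
  exact tendsto_nhds_unique h tendsto_const_nhds

theorem dist_ofElem_seq_le (x : P.Point) (n : L0 μ ℕ) :
    ∀ᵐ ω ∂μ, P.dist (P.ofElem (x.seq n)) x ω ≤ (1 / 2 : ℝ) ^ n ω := by
  filter_upwards [P.dist_tendsto (P.ofElem (x.seq n)) x,
    ae_all_iff.2 fun k : ℕ => x.fast n (AEEqFun.const Ω k),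
    ae_all_iff.2 fun k : ℕ => ae_const (μ := μ) k] with ω h1 h2 h3
  -- The rapid Cauchy bound holds only for strictly larger indices, hence the start at `n ω + 1`.
  refine le_of_tendsto h1 (eventually_atTop.2 ⟨n ω + 1, fun k hk => ?_⟩)
  exact h2 k (by rw [h3]; exact hk)

theorem dist_eq_zero (x y : P.Point) :
    ∀ᵐ ω ∂μ, (∀ k : ℕ, (x.seq (AEEqFun.const Ω k)).1 ω = (y.seq (AEEqFun.const Ω k)).1 ω) →
      P.dist x y ω = 0 := by
  filter_upwards [P.dist_tendsto x y, ae_all_iff.2 fun k : ℕ =>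
    P.d_eq_zero (x.seq (AEEqFun.const Ω k)) (y.seq (AEEqFun.const Ω k))] with ω h1 h2 h3
  refine tendsto_nhds_unique h1 ?_
  simp only [fun k => h2 k (h3 k)]
  exact tendsto_const_nhds

theorem ofElem_dist_eq_zero (a b : P.X.Elem) :
    ∀ᵐ ω ∂μ, a.1 ω = b.1 ω → P.dist (P.ofElem a) (P.ofElem b) ω = 0 := by
  rw [P.dist_ofElem]
  exact P.d_eq_zero a b

theorem exists_glue_point_dist {f : Ω → ℕ} (hf : Measurable f) (p : ℕ → P.Point) :
    ∃ q : P.Point, (∀ n, ∀ᵐ ω ∂μ, (q.seq n).1 ω = ((p (f ω)).seq n).1 ω) ∧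
      ∀ᵐ ω ∂μ, P.dist (p (f ω)) q ω = 0 := by
  obtain ⟨q, hq⟩ := P.exists_glue_point hf p
  refine ⟨q, hq, ?_⟩
  filter_upwards [ae_all_iff.2 fun k : ℕ => hq (AEEqFun.const Ω k),
    ae_all_iff.2 fun j => P.dist_eq_zero (p j) q] with ω h1 h2
  exact h2 _ fun k => (h1 k).symm

/-! ### The coded space as a conditional metric space -/

/-- The class of a point. -/
def toSpace (x : P.Point) : P.Space := Quotient.mk P.pointSetoid x

theorem toSpace_surjective : Function.Surjective P.toSpace := Quotient.exists_rep

theorem spaceDist_toSpace (x y : P.Point) :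
    P.spaceDist (P.toSpace x) (P.toSpace y) = P.dist x y := rfl

theorem space_triangle (x y z : P.Space) :
    ∀ᵐ ω ∂μ, P.spaceDist x z ω ≤ P.spaceDist x y ω + P.spaceDist y z ω := by
  obtain ⟨x, rfl⟩ := P.toSpace_surjective x
  obtain ⟨y, rfl⟩ := P.toSpace_surjective y
  obtain ⟨z, rfl⟩ := P.toSpace_surjective z
  exact P.dist_triangle x y z

theorem space_nonneg (x y : P.Space) : ∀ᵐ ω ∂μ, 0 ≤ P.spaceDist x y ω := by
  obtain ⟨x, rfl⟩ := P.toSpace_surjective x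
  obtain ⟨y, rfl⟩ := P.toSpace_surjective y
  exact P.dist_nonneg x y

theorem space_symm (x y : P.Space) : P.spaceDist x y = P.spaceDist y x := by
  obtain ⟨x, rfl⟩ := P.toSpace_surjective x
  obtain ⟨y, rfl⟩ := P.toSpace_surjective y
  exact P.dist_symm x y

theorem space_eq_zero_iff (x y : P.Space) : P.spaceDist x y = 0 ↔ x = y := by
  obtain ⟨x, rfl⟩ := P.toSpace_surjective x
  obtain ⟨y, rfl⟩ := P.toSpace_surjective y
  exact (Quotient.eq (r := P.pointSetoid)).symm

theorem space_symm_ae (x y : P.Space) :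
    ∀ᵐ ω ∂μ, P.spaceDist x y ω = P.spaceDist y x ω := by
  rw [P.space_symm]; exact Eventually.of_forall fun _ => rfl

theorem isConditionalSet_space : IsConditionalSet μ P.spaceEqOn where
  nonempty := (P.X.nonempty_elem P.nonempty).map fun a => P.toSpace (P.ofElem a)
  refl A _ x := by
    filter_upwards [ae_eq_zero ((P.space_eq_zero_iff x x).2 rfl)] with ω h _ using h
  symm A _ x y h := by
    filter_upwards [h, P.space_symm_ae x y] with ω h1 h2 hω
    rw [← h2, h1 hω]
  trans A _ x y z h1 h2 := by
    filter_upwards [h1, h2, P.space_triangle x y z, P.space_nonneg x z] with ω h1 h2 h3 h4 hω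
    rw [h1 hω, h2 hω, add_zero] at h3
    exact le_antisymm h3 h4
  congr A B _ _ hAB x y h := by
    filter_upwards [h, hAB.mem_iff] with ω h1 h2 hω
    exact h1 (h2.2 hω)
  mono A B _ _ hAB x y h := by
    filter_upwards [h] with ω h1 hω
    exact h1 (hAB hω)
  glue A hA x := by
    obtain ⟨f, hf, hfA⟩ := hA.exists_index
    choose p hp using fun k => P.toSpace_surjective (x k)
    obtain ⟨q, -, hq⟩ := P.exists_glue_point_dist hf p
    refine ⟨P.toSpace q, fun k => ?_, fun z hz => ?_⟩
    · filter_upwards [hq] with ω h hω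
      rw [← hp k, P.spaceDist_toSpace, ← (hfA k ω).1 hω, h]
    · rw [← P.space_eq_zero_iff]
      apply eq_zero_of_ae
      filter_upwards [hq, ae_all_iff.2 hz, P.space_nonneg z (P.toSpace q),
        ae_all_iff.2 fun k => P.space_triangle z (x k) (P.toSpace q),
        ae_all_iff.2 fun k => P.space_symm_ae z (x k)] with ω h1 h2 h3 h4 h5
      have e1 := h4 (f ω)
      have e2 := h2 (f ω) ((hfA _ ω).2 rfl)
      have e3 := h5 (f ω)
      have e4 : P.spaceDist (x (f ω)) (P.toSpace q) ω = 0 := by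
        rw [← hp, P.spaceDist_toSpace, h1]
      linarith

theorem isConditionalMetric_space : IsConditionalMetric μ P.spaceEqOn P.spaceDist where
  nonneg := P.space_nonneg
  eq_zero_iff := P.space_eq_zero_iff
  symm := P.space_symm
  triangle := P.space_triangle
  concat A hA x y z w hx hy k := by
    filter_upwards [hx k, hy k, P.space_triangle (x k) z (y k), P.space_triangle z w (y k),
      P.space_triangle z (x k) w, P.space_triangle (x k) (y k) w, P.space_symm_ae (x k) z,
      P.space_symm_ae (y k) w] with ω h1 h2 h3 h4 h5 h6 h7 h8 hω
    have := h1 hω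
    have := h2 hω
    apply le_antisymm <;> linarith

end PolishCode

/-! ### Density of `X`, separability and completeness of the coded space. -/

namespace PolishCode

variable (P : PolishCode μ)

/-- The canonical map from `X` to the coded space. -/
def embed (a : P.X.Elem) : P.Space := P.toSpace (P.ofElem a)

theorem spaceDist_embed (a b : P.X.Elem) : P.spaceDist (P.embed a) (P.embed b) = P.d a b :=
  P.dist_ofElem a b

theorem spaceDist_embed_eq_zero (a b : P.X.Elem) :
    ∀ᵐ ω ∂μ, a.1 ω = b.1 ω → P.spaceDist (P.embed a) (P.embed b) ω = 0 :=
  P.ofElem_dist_eq_zero a b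

theorem exists_embed_le (s : P.Space) (n : L0 μ ℕ) :
    ∃ a, ∀ᵐ ω ∂μ, P.spaceDist (P.embed a) s ω ≤ (1 / 2 : ℝ) ^ n ω := by
  obtain ⟨x, rfl⟩ := P.toSpace_surjective s
  exact ⟨x.seq n, P.dist_ofElem_seq_le x n⟩

theorem exists_embed_le_pow (s : P.Space) (j : ℕ) :
    ∃ a, ∀ᵐ ω ∂μ, P.spaceDist (P.embed a) s ω ≤ (1 / 2 : ℝ) ^ j := by
  obtain ⟨a, ha⟩ := P.exists_embed_le s (AEEqFun.const Ω j)
  refine ⟨a, ?_⟩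
  filter_upwards [ha, ae_const (μ := μ) j] with ω h1 h2
  rwa [h2] at h1

theorem exists_embed_lt (s : P.Space) (r : L0 μ ℚ) (hr : ∀ᵐ ω ∂μ, 0 < r ω) :
    ∃ a, ∀ᵐ ω ∂μ, P.spaceDist (P.embed a) s ω < r ω := by
  obtain ⟨h, hh⟩ := exists_pow_lt_rat
  have hm : Measurable h := measurable_of_countable h
  obtain ⟨a, ha⟩ := P.exists_embed_le s (AEEqFun.compMeasurable h hm r)
  refine ⟨a, ?_⟩
  filter_upwards [ha, hr, AEEqFun.coeFn_compMeasurable h hm r] with ω h1 h2 h3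
  rw [h3] at h1
  exact h1.trans_lt (hh _ h2)

/-- A rapid Cauchy sequence of elements of `X` converges in the coded space. -/
theorem exists_limit {a : ℕ → P.X.Elem}
    (ha : ∀ᵐ ω ∂μ, ∀ k l, k < l → P.d (a k) (a l) ω ≤ (1 / 2 : ℝ) ^ k) :
    ∃ s : P.Space, ∀ᵐ ω ∂μ, ∀ k : ℕ, P.spaceDist (P.embed (a k)) s ω ≤ (1 / 2 : ℝ) ^ k := by
  obtain ⟨x, hx⟩ := P.exists_point ha
  refine ⟨P.toSpace x, ae_all_iff.2 fun k => ?_⟩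
  filter_upwards [P.dist_ofElem_seq_le x (AEEqFun.const Ω k), hx (AEEqFun.const Ω k),
    P.space_triangle (P.embed (a k)) (P.embed (x.seq (AEEqFun.const Ω k))) (P.toSpace x),
    P.spaceDist_embed_eq_zero (a k) (x.seq (AEEqFun.const Ω k)), ae_const (μ := μ) k]
    with ω h1 h2 h3 h4 h5
  rw [h5] at h1 h2
  rw [h4 h2.symm, zero_add] at h3
  exact h3.trans h1

theorem isConditionallySeparable_space [SFinite μ] :
    IsConditionallySeparable μ P.spaceEqOn P.spaceDist := by
  obtain ⟨g, hg⟩ := P.X.exists_generators P.nonempty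
  refine ⟨Set.range fun k => P.embed (g k), Set.countable_range _, fun s => ?_⟩
  choose a ha using P.exists_embed_le_pow s
  -- The indices have to increase strictly, while the wanted generator index `a m ω` need not.
  -- Pairing it with the successor of the previous index forces growth, and unpairing recovers the
  -- generator.
  let N : ℕ → Ω → ℕ := fun m => Nat.rec (fun ω => Nat.pair ((a 0).1 ω) 0)
    (fun m f ω => Nat.pair ((a (m + 1)).1 ω) (f ω + 1)) m
  have hpair : Measurable fun p : ℕ × ℕ => Nat.pair p.1 p.2 := measurable_of_countable _
  have hN : ∀ m, Measurable (N m) := by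
    intro m
    induction m with
    | zero => exact hpair.comp ((a 0).1.measurable.prodMk measurable_const)
    | succ m ih =>
      exact hpair.comp ((a (m + 1)).1.measurable.prodMk
        ((measurable_of_countable fun k : ℕ => k + 1).comp ih))
  have hN1 : ∀ m ω, (Nat.unpair (N m ω)).1 = (a m).1 ω := by
    intro m ω
    cases m <;> simp [N]
  have hN2 : ∀ m ω, N m ω < N (m + 1) ω := fun m ω =>
    (Nat.lt_succ_self _).trans_le (Nat.right_le_pair _ _)
  choose n hn using fun m => exists_L0_eq (μ := μ) (hN m)
  refine ⟨fun k => P.embed (g (Nat.unpair k).1), fun k => ⟨_, rfl⟩, n, fun m => ?_,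
    fun m => P.embed (a m), fun m => ?_, ?_⟩
  · filter_upwards [hn m, hn (m + 1)] with ω h1 h2
    rw [h1, h2]
    exact hN2 m ω
  · rw [isConcat_level_iff P.isConditionalSet_space P.isConditionalMetric_space]
    filter_upwards [hn m, hg (a m),
      ae_all_iff.2 fun k => P.spaceDist_embed_eq_zero (g k) (a m)] with ω h1 h2 h3
    rw [h1, hN1]
    exact h3 _ h2
  · filter_upwards [ae_all_iff.2 ha, ae_all_iff.2 fun m => P.space_nonneg (P.embed (a m)) s]
      with ω h1 h2
    exact squeeze_zero h2 h1
      (tendsto_pow_atTop_nhds_zero_of_lt_one (by norm_num) (by norm_num))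

end PolishCode

/-- A conditional Cauchy sequence is Cauchy almost everywhere, with measurable moduli. -/
theorem IsConditionalCauchy.exists_modulus {H : Type v} {R : Set Ω → H → H → Prop}
    {d : H → H → L0 μ ℝ} (hs : IsConditionalSet μ R) (hd : IsConditionalMetric μ R d)
    {x : ℕ → H} (hx : IsConditionalCauchy R d x) (j : ℕ) :
    ∃ n : L0 μ ℕ, ∀ᵐ ω ∂μ, ∀ k l, n ω ≤ k → n ω ≤ l → d (x k) (x l) ω ≤ (1 / 2 : ℝ) ^ j := by
  have hc := ae_const (μ := μ) ((1 / 2 : ℚ) ^ j)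
  obtain ⟨n, hn⟩ := hx (AEEqFun.const Ω ((1 / 2 : ℚ) ^ j)) (by
    filter_upwards [hc] with ω h
    rw [h]; positivity)
  refine ⟨n, ae_all_iff.2 fun k => ae_all_iff.2 fun l => ?_⟩
  -- The Cauchy condition admits only indices that dominate `n` everywhere; `max n k` does, and
  -- equals `k` where `n ω ≤ k`.
  have hmax : ∀ k : ℕ, Measurable fun ω => max (n ω) k := fun k =>
    n.measurable.max measurable_const
  obtain ⟨m, hm⟩ := exists_L0_eq (μ := μ) (hmax k)
  obtain ⟨p, hp⟩ := exists_L0_eq (μ := μ) (hmax l)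
  obtain ⟨a, ha⟩ := exists_glue hs hd m.measurable x
  obtain ⟨b, hb⟩ := exists_glue hs hd p.measurable x
  have h := hn m p (by filter_upwards [hm] with ω h; rw [h]; exact le_max_left _ _)
    (by filter_upwards [hp] with ω h; rw [h]; exact le_max_left _ _) a b
    ((isConcat_level_iff hs hd).2 ha) ((isConcat_level_iff hs hd).2 hb)
  filter_upwards [h, hc, hm, hp, ha, hb, hd.triangle (x k) a (x l), hd.triangle a b (x l),
    hd.symm_ae (x l) b] with ω h h0 h1 h2 h3 h4 h5 h6 h7 hk hl
  rw [h1, max_eq_right hk] at h3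
  rw [h2, max_eq_right hl] at h4
  rw [h0] at h
  push_cast at h
  linarith

namespace PolishCode

variable (P : PolishCode μ)

theorem isConditionallyComplete_space : IsConditionallyComplete μ P.spaceEqOn P.spaceDist := by
  intro x hx
  have hs := P.isConditionalSet_space
  have hd := P.isConditionalMetric_space
  choose n hn using hx.exists_modulus hs hd
  -- The sum dominates all moduli `n i` with `i ≤ j`, so `y j` is as close to the tail of `x` as
  -- each of these moduli demands.
  have hN : ∀ j, Measurable fun ω => ∑ i ∈ Finset.range (j + 1), n i ω := fun j =>
    Finset.measurable_fun_sum _ fun i _ => (n i).measurable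
  choose y hy using fun j => exists_glue hs hd (hN j) x
  choose e he using fun j => P.exists_embed_le_pow (y j) j
  have hle : ∀ i j, i ≤ j → ∀ ω, n i ω ≤ ∑ i ∈ Finset.range (j + 1), n i ω := fun i j hij ω =>
    Finset.single_le_sum (f := fun i => n i ω) (fun _ _ => Nat.zero_le _)
      (Finset.mem_range.2 (Nat.lt_succ_of_le hij))
  have hpow : ∀ i j : ℕ, i ≤ j → (1 / 2 : ℝ) ^ j ≤ (1 / 2 : ℝ) ^ i := fun i j h =>
    pow_le_pow_of_le_one (by norm_num) (by norm_num) h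
  have hxe : ∀ᵐ ω ∂μ, ∀ i j, i ≤ j → ∀ k, n i ω ≤ k →
      P.spaceDist (x k) (P.embed (e j)) ω ≤ (1 / 2 : ℝ) ^ i + (1 / 2 : ℝ) ^ j := by
    filter_upwards [ae_all_iff.2 hn, ae_all_iff.2 hy, ae_all_iff.2 he,
      hd.ae_triangle x x (fun j => P.embed (e j)), hd.ae_triangle x y (fun j => P.embed (e j)),
      ae_all_iff.2 fun j => P.space_symm_ae (P.embed (e j)) (y j)] with ω h1 h2 h3 h4 h5 h6
    intro i j hij k hk
    have e1 := h1 i k _ hk (hle i j hij ω)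
    have e2 := h2 j
    have e3 := h3 j
    have e4 := h4 k (∑ i ∈ Finset.range (j + 1), n i ω) j
    have e5 := h5 (∑ i ∈ Finset.range (j + 1), n i ω) j j
    have e6 := h6 j
    linarith
  -- Passing through a common `x` term costs at most four errors of size `2^-(k+3)`; the shift by 3
  -- absorbs them.
  have hfast : ∀ᵐ ω ∂μ, ∀ k l, k < l →
      P.d (e (k + 3)) (e (l + 3)) ω ≤ (1 / 2 : ℝ) ^ k := by
    filter_upwards [hxe, hd.ae_triangle (fun j => P.embed (e j)) x (fun j => P.embed (e j)),
      ae_all_iff.2 fun j => ae_all_iff.2 fun k => P.space_symm_ae (P.embed (e j)) (x k)]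
      with ω h1 h2 h3 k l hkl
    have e1 := h1 (k + 3) (k + 3) le_rfl _ le_rfl
    have e2 := h1 (k + 3) (l + 3) (by omega) _ le_rfl
    have e3 := h2 (k + 3) (n (k + 3) ω) (l + 3)
    have e4 := hpow (k + 3) (l + 3) (by omega)
    rw [h3, P.spaceDist_embed] at e3
    have e5 : (1 / 2 : ℝ) ^ (k + 3) = (1 / 2) ^ k / 8 := by rw [pow_add]; norm_num; ring
    have e6 : (0 : ℝ) < (1 / 2) ^ k := by positivity
    linarith
  obtain ⟨s, hs⟩ := P.exists_limit hfast
  refine ⟨s, ?_⟩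
  filter_upwards [hs, hxe, hd.ae_triangle x (fun j => P.embed (e j)) (fun _ => s),
    ae_all_iff.2 fun k => P.space_nonneg (x k) s] with ω h1 h2 h3 h4
  refine tendsto_zero_of_le_pow h4 fun j => ⟨n j ω, fun k hk => ?_⟩
  have e1 := h1 j
  have e2 := h2 j (j + 3) (by omega) k hk
  have e3 := h3 k (j + 3) 0
  have e4 := hpow j (j + 3) (by omega)
  linarith

/-- A Polish space in the model is a conditional Polish space. -/
theorem isConditionalPolish_space [SFinite μ] :
    IsConditionalPolish μ P.spaceEqOn P.spaceDist where
  condSet := P.isConditionalSet_space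
  condMetric := P.isConditionalMetric_space
  separable := P.isConditionallySeparable_space
  complete := P.isConditionallyComplete_space

end PolishCode

/-! ### Isometries -/

section Isometry

variable {H : Type v} {R : Set Ω → H → H → Prop} {d : H → H → L0 μ ℝ}
  {H' : Type w} {R' : Set Ω → H' → H' → Prop} {d' : H' → H' → L0 μ ℝ}

theorem CondIsometric.symm (h : CondIsometric R d R' d') : CondIsometric R' d' R d := by
  obtain ⟨f, h1, h2⟩ := h
  refine ⟨f.symm, fun A hA x y => ?_, fun x y => ?_⟩
  · rw [h1 A hA]; simp
  · rw [← h2]; simp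

theorem CondIsometric.trans {H'' : Type*} {R'' : Set Ω → H'' → H'' → Prop}
    {d'' : H'' → H'' → L0 μ ℝ} (h : CondIsometric R d R' d') (h' : CondIsometric R' d' R'' d'') :
    CondIsometric R d R'' d'' := by
  obtain ⟨f, h1, h2⟩ := h
  obtain ⟨g, h3, h4⟩ := h'
  refine ⟨f.trans g, fun A hA x y => ?_, fun x y => ?_⟩
  · rw [h1 A hA, h3 A hA]; rfl
  · rw [← h2, ← h4]; rfl

/-- A distance preserving map from `X` into a conditional Polish space with dense image extends to
an isometry of the coded space. -/
theorem condIsometric_of_dense (P : PolishCode μ) (hH : IsConditionalPolish μ R d)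
    (φ : P.X.Elem → H) (hφ : ∀ a b, d (φ a) (φ b) = P.d a b)
    (hdense : ∀ (h : H) (j : ℕ), ∃ a, ∀ᵐ ω ∂μ, d (φ a) h ω ≤ (1 / 2 : ℝ) ^ j) :
    CondIsometric P.spaceEqOn P.spaceDist R d := by
  have hs := hH.condSet
  have hd := hH.condMetric
  have hlim : ∀ x : P.Point, ∃ h, ∀ᵐ ω ∂μ,
      Tendsto (fun k : ℕ => d (φ (x.seq (AEEqFun.const Ω k))) h ω) atTop (𝓝 0) := by
    intro x
    apply exists_tendsto_of_fast hs hd hH.complete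
    simp only [hφ]
    refine ae_all_iff.2 fun k => ae_all_iff.2 fun l => ?_
    filter_upwards [x.fast (AEEqFun.const Ω k) (AEEqFun.const Ω l), ae_const (μ := μ) k,
      ae_const (μ := μ) l] with ω h1 h2 h3 hkl
    rw [h2, h3] at h1
    exact h1 hkl
  choose F hF using hlim
  have hFd : ∀ x y, d (F x) (F y) = P.dist x y := by
    intro x y
    refine dist_eq_of_tendsto hd (hF x) (hF y) ?_
    simp only [hφ]
    exact P.dist_tendsto x y
  let f : P.Space → H := Quotient.lift (s := P.pointSetoid) F fun x y (h : P.dist x y = 0) =>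
    (hd.eq_zero_iff _ _).1 ((hFd x y).trans h)
  have hfF : ∀ x, f (P.toSpace x) = F x := fun _ => rfl
  have hfd : ∀ s t, d (f s) (f t) = P.spaceDist s t := by
    intro s t
    obtain ⟨x, rfl⟩ := P.toSpace_surjective s
    obtain ⟨y, rfl⟩ := P.toSpace_surjective t
    exact hFd x y
  have hinj : Function.Injective f := fun s t h => by
    rw [← P.space_eq_zero_iff, ← hfd, hd.eq_zero_iff, h]
  have hsurj : Function.Surjective f := by
    intro h
    choose a ha using hdense h
    -- The shift by one absorbs the two errors of the triangle inequality through `h`.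
    have hfast : ∀ᵐ ω ∂μ, ∀ k l, k < l → P.d (a (k + 1)) (a (l + 1)) ω ≤ (1 / 2 : ℝ) ^ k := by
      simp only [← hφ]
      filter_upwards [ae_all_iff.2 ha,
        hd.ae_triangle (fun k => φ (a k)) (fun _ => h) (fun k => φ (a k)),
        ae_all_iff.2 fun k => hd.symm_ae h (φ (a k))] with ω h1 h2 h3 k l hkl
      have e1 := h1 (k + 1)
      have e2 := h1 (l + 1)
      have e3 := h2 (k + 1) 0 (l + 1)
      have e4 := h3 (l + 1)
      have e5 : (1 / 2 : ℝ) ^ (l + 1) ≤ (1 / 2 : ℝ) ^ (k + 1) :=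
        pow_le_pow_of_le_one (by norm_num) (by norm_num) (by omega)
      have e6 : (1 / 2 : ℝ) ^ (k + 1) = (1 / 2) ^ k / 2 := by rw [pow_succ]; ring
      linarith
    obtain ⟨x, hx⟩ := P.exists_point hfast
    refine ⟨P.toSpace x, ?_⟩
    refine eq_of_tendsto hd (hF x) ?_
    filter_upwards [ae_all_iff.2 ha, ae_all_iff.2 fun k : ℕ => hx (AEEqFun.const Ω k),
      ae_all_iff.2 fun k : ℕ => ae_const (μ := μ) k,
      ae_all_iff.2 fun k : ℕ => hd.nonneg (φ (x.seq (AEEqFun.const Ω k))) h,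
      hd.ae_triangle (fun k : ℕ => φ (x.seq (AEEqFun.const Ω k))) (fun k => φ (a k)) (fun _ => h),
      ae_all_iff.2 fun k : ℕ => P.d_eq_zero (x.seq (AEEqFun.const Ω k)) (a (k + 1))]
      with ω h1 h2 h3 h4 h5 h6
    refine tendsto_zero_of_le_pow h4 fun j => ⟨j, fun k hk => ?_⟩
    have e1 := h5 k (k + 1) 0
    have e2 := h6 k (by rw [h2, h3])
    rw [← hφ] at e2
    have e3 := h1 (k + 1)
    have e4 : (1 / 2 : ℝ) ^ (k + 1) ≤ (1 / 2 : ℝ) ^ j :=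
      pow_le_pow_of_le_one (by norm_num) (by norm_num) (by omega)
    have e5 : (0 : ℝ) < (1 / 2) ^ j := by positivity
    linarith
  refine ⟨Equiv.ofBijective f ⟨hinj, hsurj⟩, fun A hA s t => ?_, hfd⟩
  -- Compatibility with restrictions is automatic: on both sides the relation says that the distance
  -- vanishes on `A`.
  rw [rel_iff hs hd hA]
  change _ ↔ ∀ᵐ ω ∂μ, ω ∈ A → d (f s) (f t) ω = 0
  rw [hfd]
  rfl

/-! ### Coding a conditional Polish space -/

/-- In a conditionally separable space a single sequence generates a dense subset. -/
theorem exists_dense_sequence (hs : IsConditionalSet μ R) (hd : IsConditionalMetric μ R d)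
    (h : IsConditionallySeparable μ R d) :
    ∃ g : ℕ → H, ∀ (x : H) (j : ℕ), ∃ n : L0 μ ℕ,
      ∀ᵐ ω ∂μ, d (g (n ω)) x ω ≤ (1 / 2 : ℝ) ^ j := by
  obtain ⟨G, hG, h⟩ := h
  obtain ⟨x₀⟩ := hs.nonempty
  have hne : G.Nonempty := by
    obtain ⟨y, hy, -⟩ := h x₀
    exact ⟨y 0, hy 0⟩
  obtain ⟨g, rfl⟩ := hG.exists_eq_range hne
  refine ⟨g, fun x j => ?_⟩
  obtain ⟨y, hy, n, -, z, hz, hlim⟩ := h x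
  -- `f` selects some `g k` close to `x`. One exists at almost every `ω`, since a late `z k` is
  -- close to `x` and has zero distance at `ω` to a member of the sequence `y`, which lies in the
  -- range of `g`.
  obtain ⟨f, hf, hfk⟩ := exists_measurable_choice (S := fun k => {ω | d (g k) x ω ≤ (1 / 2 : ℝ) ^ j})
    fun k => measurableSet_le (d (g k) x).measurable measurable_const
  obtain ⟨m, hm⟩ := exists_L0_eq (μ := μ) hf
  refine ⟨m, ?_⟩
  choose i hi using hy
  filter_upwards [hm, hlim, ae_all_iff.2 fun m => (isConcat_level_iff hs hd).1 (hz m),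
    hd.ae_triangle y z (fun _ => x)] with ω h1 h2 h3 h4
  rw [h1]
  apply hfk
  obtain ⟨k, hk⟩ := (h2.eventually (gt_mem_nhds (show (0 : ℝ) < (1 / 2) ^ j by positivity))).exists
  refine ⟨i (n k ω), ?_⟩
  have e1 := h4 (n k ω) k 0
  have e2 := h3 k
  change d (g (i (n k ω))) x ω ≤ _
  rw [hi]
  linarith

/-- The set of all natural numbers of the model. -/
def CondPow.univ (μ : Measure Ω) : CondPow μ where
  N := Set.univ
  nonempty := Set.univ_nonempty
  stable _ _ _ _ _ _ := Set.mem_univ _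
  A := Set.univ
  measurable := MeasurableSet.univ

theorem CondPow.univ_isNonempty : (CondPow.univ μ).IsNonempty := by
  intro C _ h
  have := h Set.univ (Set.mem_iUnion.2 ⟨AEEqFun.const Ω 0, MeasurableSet.univ, subset_rfl, _,
    Set.mem_univ (AEEqFun.const Ω 0), Eventually.of_forall fun _ _ => rfl⟩)
  rwa [Set.compl_eq_univ_sdiff]

theorem exists_polishCode (hH : IsConditionalPolish μ R d) :
    ∃ P : PolishCode μ, CondIsometric R d P.spaceEqOn P.spaceDist := by
  have hs := hH.condSet
  have hd := hH.condMetric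
  obtain ⟨g, hg⟩ := exists_dense_sequence hs hd hH.separable
  -- `γ n` is the concatenation of `g` along `n`. Different `n` may give the same element, so the
  -- pulled-back metric is in general only a pseudometric.
  choose γ hγ using fun n : L0 μ ℕ => hs.glue _ (isPartition_level n) g
  have hγc : ∀ A, IsPartition A → ∀ (a : ℕ → L0 μ ℕ) (a' : L0 μ ℕ), IsConcat EqOn A a a' →
      IsConcat R A (fun k => γ (a k)) (γ a') := by
    intro A hA a a' h k
    rw [rel_iff hs hd (hA.measurable k)]
    filter_upwards [h k, (isConcat_level_iff hs hd).1 (hγ (a k)).1,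
      (isConcat_level_iff hs hd).1 (hγ a').1,
      hd.ae_triangle (fun _ => γ (a k)) g (fun _ => γ a'), hd.nonneg (γ (a k)) (γ a'),
      ae_all_iff.2 fun j => hd.symm_ae (γ (a k)) (g j)] with ω h1 h2 h3 h4 h5 h6 hω
    have e1 := h4 0 (a' ω) 0
    have e2 := h6 (a' ω)
    rw [h1 hω] at h2
    linarith
  let P : PolishCode μ :=
    { X := CondPow.univ μ
      nonempty := CondPow.univ_isNonempty
      d := fun a b => d (γ a.1) (γ b.1)
      concat := fun A hA a b a' b' ha hb =>
        hd.concat A hA _ _ _ _ (hγc A hA (fun k => (a k).1) a'.1 ha)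
          (hγc A hA (fun k => (b k).1) b'.1 hb)
      self := fun a => (hd.eq_zero_iff _ _).2 rfl
      symm := fun a b => hd.symm _ _
      nonneg := fun a b => hd.nonneg _ _
      triangle := fun a b c => hd.triangle _ _ _ }
  refine ⟨P, CondIsometric.symm ?_⟩
  refine condIsometric_of_dense P hH (fun a => γ a.1) (fun _ _ => rfl) fun h j => ?_
  obtain ⟨n, hn⟩ := hg h j
  refine ⟨⟨n, P.X.mem_of_mem_N P.nonempty (Set.mem_univ n)⟩, ?_⟩
  filter_upwards [hn, (isConcat_level_iff hs hd).1 (hγ n).1,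
    hd.ae_triangle (fun _ => γ n) g (fun _ => h),
    ae_all_iff.2 fun j => hd.symm_ae (γ n) (g j)] with ω h1 h2 h3 h4
  have e1 := h3 0 (n ω) 0
  have e2 := h4 (n ω)
  linarith

/-! ### Isometries in the model -/

namespace PolishCode

variable {P Q : PolishCode μ}

theorem Isometric.condIsometric [SFinite μ] (h : P.Isometric Q) :
    CondIsometric P.spaceEqOn P.spaceDist Q.spaceEqOn Q.spaceDist := by
  obtain ⟨f, -, hf, hdense⟩ := h
  refine condIsometric_of_dense P Q.isConditionalPolish_space (fun a => Q.toSpace (f a)) hf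
    fun s j => ?_
  obtain ⟨b, hb⟩ := Q.exists_embed_le_pow s (j + 1)
  have hc := ae_const (μ := μ) ((1 / 2 : ℚ) ^ (j + 1))
  obtain ⟨a, ha⟩ := hdense b (AEEqFun.const Ω ((1 / 2 : ℚ) ^ (j + 1))) (by
    filter_upwards [hc] with ω h
    rw [h]; positivity)
  refine ⟨a, ?_⟩
  filter_upwards [hb, ha, hc, Q.space_triangle (Q.toSpace (f a)) (Q.embed b) s] with ω h1 h2 h3 h4
  rw [h3] at h2
  push_cast at h2
  have e1 : (1 / 2 : ℝ) ^ (j + 1) = (1 / 2) ^ j / 2 := by rw [pow_succ]; ring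
  have e2 : Q.spaceDist (Q.toSpace (f a)) (Q.embed b) ω < (1 / 2 : ℝ) ^ (j + 1) := h2
  linarith

theorem Isometric.of_condIsometric [SFinite μ]
    (h : CondIsometric P.spaceEqOn P.spaceDist Q.spaceEqOn Q.spaceDist) : P.Isometric Q := by
  obtain ⟨F, -, hF⟩ := h
  obtain ⟨g, hg⟩ := P.X.exists_generators P.nonempty
  -- Choosing a representative of `F (P.embed a)` separately for each `a` would not commute with
  -- concatenations. Representatives are chosen for the generators only and glued along `a`, so that
  -- `(f a).seq n` at `ω` depends on `a` only through `a ω`.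
  choose p hp using fun k => Q.toSpace_surjective (F (P.embed (g k)))
  choose f hf hfd using fun a : P.X.Elem => Q.exists_glue_point_dist a.1.measurable p
  have hfF : ∀ a, Q.toSpace (f a) = F (P.embed a) := by
    intro a
    rw [← Q.space_eq_zero_iff]
    apply eq_zero_of_ae
    -- On `{a = k}` the generator `g k` agrees with `a`, and `F` preserves distances, so `p k`
    -- represents `F (P.embed a)` there.
    filter_upwards [hfd a, hg a, Q.space_nonneg (Q.toSpace (f a)) (F (P.embed a)),
      ae_all_iff.2 fun k => Q.space_triangle (Q.toSpace (f a)) (Q.toSpace (p k)) (F (P.embed a)),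
      ae_all_iff.2 fun k => Q.space_symm_ae (Q.toSpace (f a)) (Q.toSpace (p k)),
      ae_all_iff.2 fun k => P.spaceDist_embed_eq_zero (g k) a] with ω h1 h2 h3 h4 h5 h6
    have e1 := h4 (a.1 ω)
    have e2 := h6 _ h2
    rw [h5, Q.spaceDist_toSpace, h1, hp, hF, e2, add_zero] at e1
    exact le_antisymm e1 h3
  refine ⟨f, fun A hA a a' h n k => ?_, fun a b => ?_, fun b r hr => ?_⟩
  · filter_upwards [h k, hf (a k) n, hf a' n] with ω h1 h2 h3 hω
    rw [h2, h3, h1 hω]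
  · rw [← Q.spaceDist_toSpace, hfF, hfF, hF, P.spaceDist_embed]
  · obtain ⟨a, ha⟩ := P.exists_embed_lt (F.symm (Q.embed b)) r hr
    refine ⟨a, ?_⟩
    rw [← Q.spaceDist_toSpace, hfF]
    change ∀ᵐ ω ∂μ, Q.spaceDist (F (P.embed a)) (Q.embed b) ω < r ω
    rw [← hF, F.apply_symm_apply] at ha
    exact ha

end PolishCode

end Isometry

end

end Cond

theorem mainTheorem9 {Ω : Type*} [MeasurableSpace Ω] (μ : Measure Ω) [SigmaFinite μ] :
    -- every Polish space in the model is a conditional Polish space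
    (∀ P : Cond.PolishCode μ, Cond.IsConditionalPolish μ P.spaceEqOn P.spaceDist) ∧
    -- every conditional Polish space is, up to isometry, a Polish space in the model
    (∀ (H : Type*) (R : Set Ω → H → H → Prop) (d : H → H → Cond.L0 μ ℝ),
      Cond.IsConditionalPolish μ R d →
        ∃ P : Cond.PolishCode μ, Cond.CondIsometric R d P.spaceEqOn P.spaceDist) ∧
    -- the correspondence is one-to-one
    (∀ (H : Type*) (R : Set Ω → H → H → Prop) (d : H → H → Cond.L0 μ ℝ)
      (H' : Type*) (R' : Set Ω → H' → H' → Prop) (d' : H' → H' → Cond.L0 μ ℝ)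
      (P P' : Cond.PolishCode μ),
      Cond.IsConditionalPolish μ R d → Cond.IsConditionalPolish μ R' d' →
      Cond.CondIsometric R d P.spaceEqOn P.spaceDist →
      Cond.CondIsometric R' d' P'.spaceEqOn P'.spaceDist →
        (Cond.CondIsometric R d R' d' ↔ P.Isometric P')) := by
  refine ⟨fun P => P.isConditionalPolish_space, fun H R d hH => Cond.exists_polishCode hH,
    fun H R d H' R' d' P P' _ _ hP hP' => ⟨fun h => ?_, fun h => ?_⟩⟩
  · exact Cond.PolishCode.Isometric.of_condIsometric ((hP.symm.trans h).trans hP')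
  · exact (hP.trans h.condIsometric).trans hP'.symm
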